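/- Let $\Omega\subset\mathbb R^n$ be a bounded domain (non-empty, open, connected), let $\varepsilon>0$, and let $\alpha\ge 0$, $\beta>0$ with $\alpha+\beta=1$. Assume $n\ge 2$, or $n=1$ and $\alpha>0$. Put $$O_\varepsilon=\{x\in\mathbb R^n\setminus\Omega:\operatorname{dist}(x,\partial\Omega)\le\varepsilon\},\quad I_\varepsilon=\{x\in\Omega:\operatorname{dist}(x,\partial\Omega)\le\varepsilon\},\quad \Omega_\varepsilon=\Omega\cup O_\varepsilon,\quad \Gamma_\varepsilon=I_\varepsilon\cup O_\varepsilon ,$$ and define the cutoff $\delta:\Omega_\varepsilon\to[0,1]$ by $\delta=0$ on $\Omega\setminus I_\varepsilon$, $\delta(x)=1-\varepsilon^{-1}\operatorname{dist}(x,\partial\Omega)$ on $I_\varepsilon$, and $\delta=1$ on $O_\varepsilon$. Let $\partial B_\varepsilon$ be the sphere $\{v\in\mathbb R^n:|v|=\varepsilon\}$ and, for $v\in\partial B_\varepsilon$, let $\mu_v$ be the uniform probability measure on the $(n-1)$-dimensional closed disk $\{z\in\mathbb R^n:\langle z,v\rangle=0,\ |z|\le\varepsilon\}$ (the Dirac mass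 at $0$ if $n=1$). Let $F:\Gamma_\varepsilon\to\mathbb R$ be Lipschitz continuous. Say that a bounded function $u:\Omega_\varepsilon\to\mathbb R$ satisfies the dynamic programming principle (DPP) with boundary data $F$ if $z\mapsto u(x+z)$ is $\mu_v$-integrable for all $x\in\Omega$ and $v\in\partial B_\varepsilon$ (which is automatic if $u$ is Borel measurable), and for all $x\in\Omega_\varepsilon$ $$u(x)=\frac{1-\delta(x)}{2}\Big[\sup_{v\in\partial B_\varepsilon}\Big(\alpha u(x+v)+\beta\int u(x+z)\,d\mu_v(z)\Big)+\inf_{v\in\partial B_\varepsilon}\Big(\alpha u(x+v)+\beta\int u(x+z)\,d\mu_v(z)\Big)\Big]+\delta(x)F(x),$$ where the first term is read as $0$ when $x\in O_\varepsilon$ (so that $u=F$ there), and the term $\delta(x)F(x)$ is read as $0$ when $x\in\Omega\setminus I_\varepsilon$. Then there is at most one bounded (Lebesgue) measurable function satisfying the DPP with boundary data $F$: if $u_1,u_2:\Omega_\varepsilon\to\mathbb R$ are bounded, measurable and satisfy it, then $u_1=u_2$ on $\Omega_\varepsilon$. -/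

import Mathlib

open MeasureTheory Set Metric

namespace OrthogonalTugOfWar

noncomputable section

/-- The outside boundary strip `O_ε = {x ∉ Ω | dist(x, ∂Ω) ≤ ε}`. -/
def outerStrip {n : ℕ} (Ω : Set (EuclideanSpace ℝ (Fin n))) (ε : ℝ) :
    Set (EuclideanSpace ℝ (Fin n)) :=
  {x | x ∉ Ω ∧ infDist x (frontier Ω) ≤ ε}

/-- The inside boundary strip `I_ε = {x ∈ Ω | dist(x, ∂Ω) ≤ ε}`. -/
def innerStrip {n : ℕ} (Ω : Set (EuclideanSpace ℝ (Fin n))) (ε : ℝ) :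
    Set (EuclideanSpace ℝ (Fin n)) :=
  {x | x ∈ Ω ∧ infDist x (frontier Ω) ≤ ε}

/-- The thickened domain `Ω_ε = Ω ∪ O_ε`. -/
def thickDomain {n : ℕ} (Ω : Set (EuclideanSpace ℝ (Fin n))) (ε : ℝ) :
    Set (EuclideanSpace ℝ (Fin n)) :=
  Ω ∪ outerStrip Ω ε

/-- The full boundary strip `Γ_ε = {x ∈ Ω_ε | dist(x, ∂Ω) ≤ ε}`. -/
def boundaryStrip {n : ℕ} (Ω : Set (EuclideanSpace ℝ (Fin n))) (ε : ℝ) :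
    Set (EuclideanSpace ℝ (Fin n)) :=
  {x | x ∈ thickDomain Ω ε ∧ infDist x (frontier Ω) ≤ ε}

open Classical in
/-- The boundary cutoff `δ`: it is `0` on `Ω \ I_ε`, equals `1 - dist(x, ∂Ω) / ε` on `I_ε`,
and is `1` on `O_ε`. (Points outside `Ω_ε` also get the value `1`; they are never used.) -/
def cutoff {n : ℕ} (Ω : Set (EuclideanSpace ℝ (Fin n))) (ε : ℝ)
    (x : EuclideanSpace ℝ (Fin n)) : ℝ :=
  if x ∈ innerStrip Ω ε then 1 - ε⁻¹ * infDist x (frontier Ω)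
  else if x ∈ Ω then 0
  else 1

/-- The uniform probability measure `μ_v` on the closed disk of radius `ε` centred at `0` in the
hyperplane orthogonal to `v`: normalised Lebesgue measure of the subspace `vᗮ` on its closed
`ε`-ball, pushed forward to the ambient space. (For `n = 1` and `v ≠ 0` it is the Dirac mass
at `0`.) -/
def diskMeasure {n : ℕ} (ε : ℝ) (v : EuclideanSpace ℝ (Fin n)) :
    Measure (EuclideanSpace ℝ (Fin n)) :=
  Measure.map (fun z : (Submodule.span ℝ {v})ᗮ => (z : EuclideanSpace ℝ (Fin n)))
    (ProbabilityTheory.cond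
      (volume : Measure (Submodule.span ℝ {v})ᗮ)
      (closedBall (0 : (Submodule.span ℝ {v})ᗮ) ε))

/-- The expression `α u(x + v) + β ∫ u(x + z) dμ_v(z)`. -/
def moveValue {n : ℕ} (α β ε : ℝ) (u : EuclideanSpace ℝ (Fin n) → ℝ)
    (x v : EuclideanSpace ℝ (Fin n)) : ℝ :=
  α * u (x + v) + β * ∫ z, u (x + z) ∂(diskMeasure ε v)

/-- The boundary-corrected operator `I` on the right-hand side of the dynamic programming
principle. -/
def dppOperator {n : ℕ} (Ω : Set (EuclideanSpace ℝ (Fin n))) (α β ε : ℝ)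
    (F u : EuclideanSpace ℝ (Fin n) → ℝ) (x : EuclideanSpace ℝ (Fin n)) : ℝ :=
  (1 - cutoff Ω ε x) / 2 *
      ((⨆ v : sphere (0 : EuclideanSpace ℝ (Fin n)) ε, moveValue α β ε u x v) +
        (⨅ v : sphere (0 : EuclideanSpace ℝ (Fin n)) ε, moveValue α β ε u x v))
    + cutoff Ω ε x * F x

/-- `u` satisfies the dynamic programming principle on `Ω_ε`. Only the values of `u` on `Ω_ε` and
those of `F` on `Γ_ε` matter. The first field says that the integrals in the equation exist at
every point of `Ω`; it is automatic when `u` is bounded and Borel on `Ω_ε`, and is only needed so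
that functions that are merely Lebesgue measurable can be considered too. At points of `O_ε` one
has `δ = 1` and the equation reads `u = F`. -/
structure SatisfiesDPP {n : ℕ} (Ω : Set (EuclideanSpace ℝ (Fin n))) (α β ε : ℝ)
    (F u : EuclideanSpace ℝ (Fin n) → ℝ) : Prop where
  integrable : ∀ x ∈ Ω, ∀ v ∈ sphere (0 : EuclideanSpace ℝ (Fin n)) ε,
    Integrable (fun z => u (x + z)) (diskMeasure ε v)
  eq : ∀ x ∈ thickDomain Ω ε, u x = dppOperator Ω α β ε F u x

end

end OrthogonalTugOfWar

namespace OrthogonalTugOfWar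

variable {n : ℕ} {Ω : Set (EuclideanSpace ℝ (Fin n))} {α β ε : ℝ}
  {F u u₁ u₂ w : EuclideanSpace ℝ (Fin n) → ℝ} {x v : EuclideanSpace ℝ (Fin n)}

/-! Put `w = u₁ - u₂` and suppose `M = sup w > 0`. Both solutions equal `F` off `Ω`, so points where
`w` is near `M` lie in `Ω`. At such a point some move value of `w` is near `M`
(`sub_le_of_forall_moveValue_sub_le`). As `β > 0`, the disk average is near `M` too, so by Markov's
inequality `w` is near `M` on most of the disk. At least a quarter of the disk raises `‖x‖ ^ 2` by
`ε ^ 2 / 4` (`quarter_le_diskMeasure_half_annulus`), so some near-maximum point lies farther out.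
Iterating leaves the bounded set `Ω`, a contradiction (`nonpos_of_exists_farther`). In dimension one
the disk is a point, and the step `± e`, available since `α > 0`, takes its place. -/

/-- A segment leaving `Ω` meets the frontier by connectedness, at a point within `ε` of its far end.
-/
lemma add_mem_thickDomain (hx : x ∈ Ω) (hv : ‖v‖ ≤ ε) : x + v ∈ thickDomain Ω ε := by
  by_cases hy : x + v ∈ Ω
  · exact Or.inl hy
  refine Or.inr ⟨hy, ?_⟩
  have hconn : IsPreconnected (segment ℝ x (x + v)) := (convex_segment x (x + v)).isPreconnected
  obtain ⟨p, hp, hpf⟩ : (segment ℝ x (x + v) ∩ frontier Ω).Nonempty := by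
    by_contra hne
    rw [Set.not_nonempty_iff_eq_empty] at hne
    have hcov : segment ℝ x (x + v) ⊆ interior Ω ∪ (closure Ω)ᶜ := by
      intro z hz
      by_contra hz'
      simp only [mem_union, mem_compl_iff, not_or, not_not] at hz'
      exact hne.subset ⟨hz, hz'.2, hz'.1⟩
    have hxi : x ∈ interior Ω := by
      rcases hcov (left_mem_segment ℝ x (x + v)) with h | h
      · exact h
      · exact absurd (subset_closure hx) h
    have hyc : x + v ∈ (closure Ω)ᶜ := by
      rcases hcov (right_mem_segment ℝ x (x + v)) with h | h
      · exact absurd (interior_subset h) hy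
      · exact h
    obtain ⟨z, -, hz1, hz2⟩ := hconn (interior Ω) (closure Ω)ᶜ isOpen_interior
      isClosed_closure.isOpen_compl hcov ⟨x, left_mem_segment ℝ x (x + v), hxi⟩
      ⟨x + v, right_mem_segment ℝ x (x + v), hyc⟩
    exact hz2 (interior_subset_closure hz1)
  have hsub : segment ℝ x (x + v) ⊆ closedBall (x + v) ε := by
    apply (convex_closedBall (x + v) ε).segment_subset
    · simpa using hv
    · exact mem_closedBall_self ((norm_nonneg v).trans hv)
  calc infDist (x + v) (frontier Ω) ≤ dist (x + v) p := infDist_le_dist_of_mem hpf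
    _ ≤ ε := by rw [dist_comm]; exact hsub hp

lemma cutoff_nonneg (hε : 0 < ε) : 0 ≤ cutoff Ω ε x := by
  unfold cutoff
  split_ifs with h
  · have := (inv_mul_le_one₀ hε).2 h.2
    linarith
  · exact le_rfl
  · exact zero_le_one

lemma cutoff_le_one (hε : 0 < ε) : cutoff Ω ε x ≤ 1 := by
  unfold cutoff
  split_ifs
  · have : 0 ≤ ε⁻¹ * infDist x (frontier Ω) := mul_nonneg (inv_nonneg.2 hε.le) infDist_nonneg
    linarith
  · exact zero_le_one
  · exact le_rfl

lemma SatisfiesDPP.eq_of_notMem (h : SatisfiesDPP Ω α β ε F u) (hx : x ∈ thickDomain Ω ε)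
    (hxΩ : x ∉ Ω) : u x = F x := by
  have hc : cutoff Ω ε x = 1 := by simp [cutoff, innerStrip, hxΩ]
  rw [h.eq x hx, dppOperator, hc]
  simp

/-! ### The disk measures. -/

lemma isProbabilityMeasure_cond_closedBall {H : Type*} [NormedAddCommGroup H]
    [InnerProductSpace ℝ H] [FiniteDimensional ℝ H] [MeasurableSpace H] [BorelSpace H]
    (hε : 0 < ε) :
    IsProbabilityMeasure (ProbabilityTheory.cond (volume : Measure H) (closedBall 0 ε)) :=
  ProbabilityTheory.cond_isProbabilityMeasure_of_finite (measure_closedBall_pos _ _ hε).ne'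
    measure_closedBall_lt_top.ne

lemma measurableEmbedding_orthogonal_coe (v : EuclideanSpace ℝ (Fin n)) :
    MeasurableEmbedding
      (fun z : (Submodule.span ℝ {v})ᗮ => (z : EuclideanSpace ℝ (Fin n))) :=
  MeasurableEmbedding.subtype_coe (Submodule.span ℝ {v})ᗮ.closed_of_finiteDimensional.measurableSet

lemma isProbabilityMeasure_diskMeasure (hε : 0 < ε) (v : EuclideanSpace ℝ (Fin n)) :
    IsProbabilityMeasure (diskMeasure ε v) := by
  have := isProbabilityMeasure_cond_closedBall (H := (Submodule.span ℝ {v})ᗮ) hε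
  exact Measure.isProbabilityMeasure_map
    (measurableEmbedding_orthogonal_coe v).measurable.aemeasurable

lemma ae_norm_le_diskMeasure (v : EuclideanSpace ℝ (Fin n)) :
    ∀ᵐ z ∂diskMeasure ε v, ‖z‖ ≤ ε := by
  rw [diskMeasure, (measurableEmbedding_orthogonal_coe v).ae_map_iff]
  filter_upwards [ProbabilityTheory.ae_cond_mem (μ := volume) measurableSet_closedBall]
    with z hz
  simpa using hz

/-- In positive dimension, a half of an annulus carries a fixed fraction of the uniform measure on
the ball. -/
lemma quarter_le_cond_half_annulus {H : Type*} [NormedAddCommGroup H]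
    [InnerProductSpace ℝ H] [FiniteDimensional ℝ H] [MeasurableSpace H] [BorelSpace H]
    (hH : 1 ≤ Module.finrank ℝ H) (hε : 0 < ε) (φ : H →L[ℝ] ℝ) :
    1 / 4 ≤ (ProbabilityTheory.cond (volume : Measure H) (closedBall 0 ε)).real
      {h | ε / 2 ≤ ‖h‖ ∧ 0 ≤ φ h} := by
  set S : Set H := {h | ε / 2 ≤ ‖h‖ ∧ 0 ≤ φ h} with hS
  set D : Set H := closedBall 0 ε with hD
  have hDpos : 0 < volume.real D := ENNReal.toReal_pos (measure_closedBall_pos _ _ hε).ne'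
    measure_closedBall_lt_top.ne
  have hDfin : volume D ≠ ⊤ := measure_closedBall_lt_top.ne
  have hneg : volume.real (D ∩ -S) = volume.real (D ∩ S) := by
    have : D ∩ -S = -(D ∩ S) := by
      ext z; simp [hD]
    rw [this, measureReal_def, Measure.measure_neg, measureReal_def]
  -- Positive dimension is needed here: halving the radius divides the volume by `2 ^ finrank ≥ 2`.
  have hball : 2 * volume.real (closedBall (0 : H) (ε / 2)) ≤ volume.real D := by
    have e1 : volume.real (closedBall (0 : H) (ε / 2))
        = (ε / 2) ^ Module.finrank ℝ H * volume.real (ball (0 : H) 1) :=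
      Measure.addHaar_real_closedBall _ _ (by positivity)
    have e2 : volume.real D = ε ^ Module.finrank ℝ H * volume.real (ball (0 : H) 1) :=
      Measure.addHaar_real_closedBall _ _ hε.le
    rw [e1, e2, ← mul_assoc]
    refine mul_le_mul_of_nonneg_right ?_ measureReal_nonneg
    have h2 : (2 : ℝ) ≤ 2 ^ Module.finrank ℝ H := le_self_pow₀ one_le_two (by omega)
    rw [div_pow, ← mul_div_assoc, div_le_iff₀ (by positivity), mul_comm]
    gcongr
  -- The half ball has at most half the volume of `D`; `S` and its reflection share the rest
  -- equally, hence the quarter.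
  have hcover : D ⊆ closedBall 0 (ε / 2) ∪ ((D ∩ S) ∪ (D ∩ -S)) := by
    intro z hz
    rcases le_total ‖z‖ (ε / 2) with h | h
    · left; simpa using h
    · right
      rcases le_total 0 (φ z) with h' | h'
      · exact Or.inl ⟨hz, h, h'⟩
      · exact Or.inr ⟨hz, by simpa [hS] using ⟨h, h'⟩⟩
  have hle : volume.real D ≤ volume.real (closedBall (0 : H) (ε / 2))
      + (volume.real (D ∩ S) + volume.real (D ∩ -S)) := by
    refine (measureReal_mono hcover ?_).trans ((measureReal_union_le _ _).trans ?_)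
    · refine (measure_union_lt_top measure_closedBall_lt_top (measure_union_lt_top ?_ ?_)).ne
      · exact (measure_mono inter_subset_left).trans_lt hDfin.lt_top
      · exact (measure_mono inter_subset_left).trans_lt hDfin.lt_top
    · gcongr
      exact measureReal_union_le _ _
  rw [measureReal_def, ProbabilityTheory.cond_apply measurableSet_closedBall, ENNReal.toReal_mul,
    ENNReal.toReal_inv, ← hD, ← measureReal_def, ← measureReal_def, inv_mul_eq_div, div_le_div_iff₀ (by norm_num) hDpos]
  linarith

lemma quarter_le_diskMeasure_half_annulus (hn : 2 ≤ n) (hε : 0 < ε)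
    (v x : EuclideanSpace ℝ (Fin n)) :
    1 / 4 ≤ (diskMeasure ε v).real {z | ε / 2 ≤ ‖z‖ ∧ 0 ≤ inner ℝ x z} := by
  have hfin : 1 ≤ Module.finrank ℝ (Submodule.span ℝ {v})ᗮ := by
    have h1 := (Submodule.span ℝ {v}).finrank_add_finrank_orthogonal
    have h2 : Module.finrank ℝ (Submodule.span ℝ {v}) ≤ 1 := by
      simpa using finrank_span_le_card (R := ℝ) ({v} : Set (EuclideanSpace ℝ (Fin n)))
    rw [finrank_euclideanSpace_fin] at h1
    omega
  rw [diskMeasure, measureReal_def, (measurableEmbedding_orthogonal_coe v).map_apply]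
  exact quarter_le_cond_half_annulus hfin hε
    ((innerSL ℝ x).comp (Submodule.span ℝ {v})ᗮ.subtypeL)

lemma diskMeasure_eq_dirac (hn : n = 1) (hε : 0 < ε) (hv : v ≠ 0) :
    diskMeasure ε v = Measure.dirac 0 := by
  have hbot : (Submodule.span ℝ {v})ᗮ = ⊥ := by
    have h1 := (Submodule.span ℝ {v}).finrank_add_finrank_orthogonal
    rw [finrank_euclideanSpace_fin, finrank_span_singleton hv] at h1
    exact Submodule.finrank_eq_zero.1 (by omega)
  have hae : ∀ᵐ z ∂diskMeasure ε v, z = 0 := by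
    rw [diskMeasure, (measurableEmbedding_orthogonal_coe v).ae_map_iff]
    refine Filter.Eventually.of_forall fun z => ?_
    exact (Submodule.mem_bot ℝ).1 (hbot.le z.2)
  have := isProbabilityMeasure_diskMeasure hε v
  rw [← Measure.map_id (μ := diskMeasure ε v), Measure.map_congr (f := id) (g := fun _ => 0) hae,
    Measure.map_const, measure_univ, one_smul]

/-! ### Comparison of two solutions through move values. -/

lemma abs_moveValue_le (hε : 0 < ε) (hα : 0 ≤ α) (hβ : 0 ≤ β) (hαβ : α + β = 1) {C : ℝ}
    (hC : ∀ y ∈ thickDomain Ω ε, |u y| ≤ C) (hx : x ∈ Ω) (hv : ‖v‖ ≤ ε) :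
    |moveValue α β ε u x v| ≤ C := by
  have := isProbabilityMeasure_diskMeasure hε v
  have h1 : |u (x + v)| ≤ C := hC _ (add_mem_thickDomain hx hv)
  have h2 : |∫ z, u (x + z) ∂diskMeasure ε v| ≤ C := by
    have := norm_integral_le_of_norm_le_const (μ := diskMeasure ε v) (f := fun z => u (x + z))
      (C := C) (by
        filter_upwards [ae_norm_le_diskMeasure v] with z hz
        exact hC _ (add_mem_thickDomain hx hz))
    simpa using this
  calc |moveValue α β ε u x v| ≤ |α * u (x + v)| + |β * ∫ z, u (x + z) ∂diskMeasure ε v| :=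
        abs_add_le _ _
    _ = α * |u (x + v)| + β * |∫ z, u (x + z) ∂diskMeasure ε v| := by
        rw [abs_mul, abs_mul, abs_of_nonneg hα, abs_of_nonneg hβ]
    _ ≤ α * C + β * C := by gcongr
    _ = C := by rw [← add_mul, hαβ, one_mul]

lemma moveValue_sub (h₁ : Integrable (fun z => u₁ (x + z)) (diskMeasure ε v))
    (h₂ : Integrable (fun z => u₂ (x + z)) (diskMeasure ε v)) :
    moveValue α β ε (u₁ - u₂) x v = moveValue α β ε u₁ x v - moveValue α β ε u₂ x v := by
  simp only [moveValue, Pi.sub_apply]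
  rw [integral_sub h₁ h₂]
  ring

/-- A bound on the differences of all move values bounds the difference of the two solutions. -/
lemma sub_le_of_forall_moveValue_sub_le [Nonempty (sphere (0 : EuclideanSpace ℝ (Fin n)) ε)]
    (hε : 0 < ε) (hα : 0 ≤ α) (hβ : 0 ≤ β) (hαβ : α + β = 1)
    {C₁ C₂ : ℝ} (hC₁ : ∀ y ∈ thickDomain Ω ε, |u₁ y| ≤ C₁)
    (hC₂ : ∀ y ∈ thickDomain Ω ε, |u₂ y| ≤ C₂)
    (h₁ : SatisfiesDPP Ω α β ε F u₁) (h₂ : SatisfiesDPP Ω α β ε F u₂) (hx : x ∈ Ω)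
    {c : ℝ} (hc : 0 ≤ c)
    (h : ∀ v ∈ sphere (0 : EuclideanSpace ℝ (Fin n)) ε, moveValue α β ε (u₁ - u₂) x v ≤ c) :
    (u₁ - u₂) x ≤ c := by
  have hb₁ : ∀ v : sphere (0 : EuclideanSpace ℝ (Fin n)) ε, |moveValue α β ε u₁ x v| ≤ C₁ :=
    fun v => abs_moveValue_le hε hα hβ hαβ hC₁ hx (mem_sphere_zero_iff_norm.1 v.2).le
  have hb₂ : ∀ v : sphere (0 : EuclideanSpace ℝ (Fin n)) ε, |moveValue α β ε u₂ x v| ≤ C₂ :=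
    fun v => abs_moveValue_le hε hα hβ hαβ hC₂ hx (mem_sphere_zero_iff_norm.1 v.2).le
  have hd : ∀ v : sphere (0 : EuclideanSpace ℝ (Fin n)) ε,
      moveValue α β ε u₁ x v ≤ moveValue α β ε u₂ x v + c := by
    intro v
    have := h v v.2
    rw [moveValue_sub (h₁.integrable x hx v v.2) (h₂.integrable x hx v v.2)] at this
    linarith
  have hsup : (⨆ v : sphere (0 : EuclideanSpace ℝ (Fin n)) ε, moveValue α β ε u₁ x v)
      ≤ (⨆ v : sphere (0 : EuclideanSpace ℝ (Fin n)) ε, moveValue α β ε u₂ x v) + c := by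
    refine ciSup_le fun v => (hd v).trans ?_
    gcongr
    exact le_ciSup (f := fun v : sphere (0 : EuclideanSpace ℝ (Fin n)) ε =>
      moveValue α β ε u₂ x v) ⟨C₂, forall_mem_range.2 fun v => (abs_le.1 (hb₂ v)).2⟩ v
  have hinf : (⨅ v : sphere (0 : EuclideanSpace ℝ (Fin n)) ε, moveValue α β ε u₁ x v)
      ≤ (⨅ v : sphere (0 : EuclideanSpace ℝ (Fin n)) ε, moveValue α β ε u₂ x v) + c := by
    rw [← sub_le_iff_le_add]
    refine le_ciInf fun v => ?_
    rw [sub_le_iff_le_add]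
    exact (ciInf_le (f := fun v : sphere (0 : EuclideanSpace ℝ (Fin n)) ε =>
      moveValue α β ε u₁ x v) ⟨-C₁, forall_mem_range.2 fun v => (abs_le.1 (hb₁ v)).1⟩ v).trans
      (hd v)
  rw [Pi.sub_apply, h₁.eq x (Or.inl hx), h₂.eq x (Or.inl hx), dppOperator, dppOperator]
  -- The terms in `F` cancel, leaving `(1 - δ) * c`, which is at most `c` because `c ≥ 0`.
  have h0 := cutoff_nonneg (Ω := Ω) (x := x) hε
  have h1 := cutoff_le_one (Ω := Ω) (x := x) hε
  nlinarith [mul_le_mul_of_nonneg_left (add_le_add hsup hinf) (sub_nonneg.2 h1),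
    mul_nonneg h0 hc]

/-! ### Moving near-maximum points outward. -/

lemma norm_sq_add_le_of_inner_nonneg {x z : EuclideanSpace ℝ (Fin n)} (h : 0 ≤ inner ℝ x z) :
    ‖x‖ ^ 2 + ‖z‖ ^ 2 ≤ ‖x + z‖ ^ 2 := by
  rw [norm_add_sq_real]
  linarith

/-- From a near-maximum point the orthogonal noise reaches a near-maximum point further from the
origin. -/
lemma exists_farther_of_two_le (hn : 2 ≤ n)
    (hε : 0 < ε) (hα : 0 ≤ α) (hβ : 0 < β) (hαβ : α + β = 1)
    {C₁ C₂ : ℝ} (hC₁ : ∀ y ∈ thickDomain Ω ε, |u₁ y| ≤ C₁)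
    (hC₂ : ∀ y ∈ thickDomain Ω ε, |u₂ y| ≤ C₂)
    (h₁ : SatisfiesDPP Ω α β ε F u₁) (h₂ : SatisfiesDPP Ω α β ε F u₂)
    {M : ℝ} (hM : 0 < M) (hle : ∀ y ∈ thickDomain Ω ε, (u₁ - u₂) y ≤ M) {η : ℝ} (hη : 0 < η) :
    ∃ η' > 0, ∀ x ∈ Ω, M - η' < (u₁ - u₂) x →
      ∃ y ∈ thickDomain Ω ε, M - η < (u₁ - u₂) y ∧ ‖x‖ ^ 2 + ε ^ 2 / 4 ≤ ‖y‖ ^ 2 := by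
  have : Nontrivial (EuclideanSpace ℝ (Fin n)) :=
    Module.nontrivial_of_finrank_pos (R := ℝ) (by rw [finrank_euclideanSpace_fin]; omega)
  have : Nonempty (sphere (0 : EuclideanSpace ℝ (Fin n)) ε) :=
    (NormedSpace.sphere_nonempty.2 hε.le).to_subtype
  -- A deficit of `η` on a quarter of the disk, weighted by `β`, costs `β * η / 4`; the cap `M`
  -- keeps the bound `M - η'` nonnegative.
  refine ⟨min M (β * η / 4), by positivity, fun x hx hxM => ?_⟩
  by_contra! hno
  refine hxM.not_ge (sub_le_of_forall_moveValue_sub_le hε hα hβ.le hαβ hC₁ hC₂ h₁ h₂ hx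
    (sub_nonneg.2 (min_le_left _ _)) fun v hv => ?_)
  have := isProbabilityMeasure_diskMeasure hε v
  have hv' : ‖v‖ ≤ ε := (mem_sphere_zero_iff_norm.1 hv).le
  have hint : Integrable (fun z => (u₁ - u₂) (x + z)) (diskMeasure ε v) :=
    (h₁.integrable x hx v hv).sub (h₂.integrable x hx v hv)
  have hmarkov := mul_meas_ge_le_integral_of_nonneg (μ := diskMeasure ε v)
    (f := fun z => M - (u₁ - u₂) (x + z)) (by
      filter_upwards [ae_norm_le_diskMeasure v] with z hz
      exact sub_nonneg.2 (hle _ (add_mem_thickDomain hx hz))) ((integrable_const M).sub hint) η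
  have hmass : (1 : ℝ) / 4 ≤ (diskMeasure ε v).real {z | η ≤ M - (u₁ - u₂) (x + z)} := by
    refine (quarter_le_diskMeasure_half_annulus hn hε v x).trans ?_
    refine ENNReal.toReal_mono (measure_ne_top _ _) (measure_mono_ae ?_)
    filter_upwards [ae_norm_le_diskMeasure v] with z hz hzS
    have hfar : ‖x‖ ^ 2 + ε ^ 2 / 4 ≤ ‖x + z‖ ^ 2 := by
      have := norm_sq_add_le_of_inner_nonneg hzS.2
      have : (ε / 2) ^ 2 ≤ ‖z‖ ^ 2 := pow_le_pow_left₀ (by positivity) hzS.1 2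
      linarith
    by_contra hlt
    have hlt' : M - η < (u₁ - u₂) (x + z) := by
      have : ¬ η ≤ M - (u₁ - u₂) (x + z) := hlt
      linarith
    exact (hno _ (add_mem_thickDomain hx hz) hlt').not_ge hfar
  rw [integral_sub (integrable_const M) hint, integral_const, probReal_univ, one_smul] at hmarkov
  have h3 : η * (1 / 4) ≤ η * (diskMeasure ε v).real {z | η ≤ M - (u₁ - u₂) (x + z)} := by gcongr
  have h4 : ∫ z, (u₁ - u₂) (x + z) ∂diskMeasure ε v ≤ M - η / 4 := by linarith
  have h5 : α * (u₁ - u₂) (x + v) ≤ α * M := by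
    gcongr
    exact hle _ (add_mem_thickDomain hx hv')
  calc moveValue α β ε (u₁ - u₂) x v ≤ α * M + β * (M - η / 4) := by unfold moveValue; gcongr
    _ = (α + β) * M - β * η / 4 := by ring
    _ ≤ M - min M (β * η / 4) := by rw [hαβ, one_mul]; gcongr; exact min_le_right _ _

lemma eq_or_eq_neg_of_norm_eq (hn : n = 1) {e : EuclideanSpace ℝ (Fin n)} (he : e ≠ 0)
    (h : ‖v‖ = ‖e‖) : v = e ∨ v = -e := by
  obtain ⟨c, rfl⟩ := (finrank_eq_one_iff_of_nonzero' e he).1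
    (by rw [finrank_euclideanSpace_fin, hn]) v
  have hc : |c| = 1 := by
    rw [norm_smul, Real.norm_eq_abs] at h
    exact mul_right_cancel₀ (norm_ne_zero_iff.2 he) (h.trans (one_mul _).symm)
  rcases eq_or_eq_neg_of_abs_eq hc with rfl | rfl
  · simp
  · simp

/-- The sphere has just two points, and max plus min of two numbers is their sum; this makes the
operator affine in dimension one. -/
lemma iSup_add_iInf_sphere (hn : n = 1) (hε : 0 < ε) {e : EuclideanSpace ℝ (Fin n)}
    (he : ‖e‖ = ε) (f : EuclideanSpace ℝ (Fin n) → ℝ) :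
    (⨆ v : sphere (0 : EuclideanSpace ℝ (Fin n)) ε, f v) +
      (⨅ v : sphere (0 : EuclideanSpace ℝ (Fin n)) ε, f v) = f e + f (-e) := by
  have he0 : e ≠ 0 := by rintro rfl; simp at he; exact hε.ne he
  have hmem : e ∈ sphere (0 : EuclideanSpace ℝ (Fin n)) ε := by simpa using he
  have hmem' : -e ∈ sphere (0 : EuclideanSpace ℝ (Fin n)) ε := by simpa using he
  have hran : range (fun v : sphere (0 : EuclideanSpace ℝ (Fin n)) ε => f v) = {f e, f (-e)} := by
    ext t
    constructor
    · rintro ⟨v, rfl⟩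
      rcases eq_or_eq_neg_of_norm_eq hn he0 ((mem_sphere_zero_iff_norm.1 v.2).trans he.symm)
        with h | h
      · simp [h]
      · simp [h]
    · rintro (rfl | rfl)
      · exact ⟨⟨e, hmem⟩, rfl⟩
      · exact ⟨⟨-e, hmem'⟩, rfl⟩
  rw [iSup, iInf, hran, csSup_pair, csInf_pair]
  exact max_add_min _ _

/-- The one-dimensional counterpart of `exists_farther_of_two_le`, where the tug-of-war step is
used instead of the noise. -/
lemma exists_farther_of_eq_one (hn : n = 1)
    (hε : 0 < ε) (hα : 0 < α) (hαβ : α + β = 1)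
    (h₁ : SatisfiesDPP Ω α β ε F u₁) (h₂ : SatisfiesDPP Ω α β ε F u₂)
    {M : ℝ} (hM : 0 < M) (hle : ∀ y ∈ thickDomain Ω ε, (u₁ - u₂) y ≤ M) {η : ℝ} (hη : 0 < η) :
    ∃ η' > 0, ∀ x ∈ Ω, M - η' < (u₁ - u₂) x →
      ∃ y ∈ thickDomain Ω ε, M - η < (u₁ - u₂) y ∧ ‖x‖ ^ 2 + ε ^ 2 / 4 ≤ ‖y‖ ^ 2 := by
  have : Nontrivial (EuclideanSpace ℝ (Fin n)) :=
    Module.nontrivial_of_finrank_pos (R := ℝ) (by rw [finrank_euclideanSpace_fin]; omega)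
  -- The cap `M` forces `w x > 0`; `η / 2` suffices because `w (x + e) ≥ 2 * w x - w (x - e)` and `w
  -- (x - e) ≤ M`.
  refine ⟨min M (η / 2), by positivity, fun x hx hxM => ?_⟩
  obtain ⟨e, he, hxe⟩ : ∃ e : EuclideanSpace ℝ (Fin n), ‖e‖ = ε ∧ 0 ≤ inner ℝ x e := by
    obtain ⟨e, he⟩ := NormedSpace.sphere_nonempty (x := (0 : EuclideanSpace ℝ (Fin n))).2 hε.le
    rw [mem_sphere_zero_iff_norm] at he
    rcases le_total 0 (inner ℝ x e) with h | h
    · exact ⟨e, he, h⟩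
    · exact ⟨-e, by rwa [norm_neg], by rw [inner_neg_right]; linarith⟩
  have hmv : ∀ (u : EuclideanSpace ℝ (Fin n) → ℝ) (v : EuclideanSpace ℝ (Fin n)), ‖v‖ = ε →
      moveValue α β ε u x v = α * u (x + v) + β * u x := by
    intro u v hv
    have hv0 : v ≠ 0 := by rintro rfl; simp at hv; exact hε.ne hv
    rw [moveValue, diskMeasure_eq_dirac hn hε hv0, integral_dirac, add_zero]
  have hop : ∀ u, dppOperator Ω α β ε F u x = (1 - cutoff Ω ε x) / 2 *
      (α * (u (x + e) + u (x + -e)) + 2 * β * u x) + cutoff Ω ε x * F x := by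
    intro u
    rw [dppOperator, iSup_add_iInf_sphere hn hε he, hmv u e he, hmv u (-e) (by rwa [norm_neg])]
    ring
  have hw : (u₁ - u₂) x = (1 - cutoff Ω ε x) *
      (α * ((u₁ - u₂) (x + e) + (u₁ - u₂) (x + -e)) / 2 + β * (u₁ - u₂) x) := by
    have e₁ := h₁.eq x (Or.inl hx)
    have e₂ := h₂.eq x (Or.inl hx)
    rw [hop] at e₁ e₂
    simp only [Pi.sub_apply]
    linear_combination e₁ - e₂
  have hwpos : 0 < (u₁ - u₂) x := by
    have := min_le_left M (η / 2)
    linarith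
  set A := α * ((u₁ - u₂) (x + e) + (u₁ - u₂) (x + -e)) / 2 + β * (u₁ - u₂) x with hA
  have h0 := cutoff_nonneg (Ω := Ω) (x := x) hε
  have h1 := cutoff_le_one (Ω := Ω) (x := x) hε
  have hApos : 0 < A := by
    by_contra! hA0
    have := mul_nonpos_of_nonneg_of_nonpos (sub_nonneg.2 h1) hA0
    linarith
  have hwA : (u₁ - u₂) x ≤ A := by nlinarith
  have hminus := hle _ (add_mem_thickDomain hx (v := -e) (by rw [norm_neg]; exact he.le))
  -- The `β` term is absorbed since `1 - β = α`, and `α > 0` is divided out.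
  have hsum : 2 * (u₁ - u₂) x ≤ (u₁ - u₂) (x + e) + (u₁ - u₂) (x + -e) := by
    obtain rfl : β = 1 - α := by linarith
    refine le_of_mul_le_mul_left ?_ hα
    rw [hA] at hwA
    linarith
  refine ⟨x + e, add_mem_thickDomain hx he.le, ?_, ?_⟩
  · have := min_le_right M (η / 2)
    linarith
  · have := norm_sq_add_le_of_inner_nonneg hxe
    rw [he] at this
    nlinarith [sq_nonneg ε]

/-- If near-maximum points of `w` can always be moved away from the origin, then `w` is nonpositive
as soon as it is so outside the bounded set `Ω`. -/
lemma nonpos_of_exists_farther {T : Set (EuclideanSpace ℝ (Fin n))}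
    (hΩb : Bornology.IsBounded Ω) (hε : 0 < ε)
    (hb : BddAbove (w '' T)) (hout : ∀ y ∈ T, y ∉ Ω → w y ≤ 0)
    (hstep : ∀ M > 0, (∀ y ∈ T, w y ≤ M) → ∀ η > 0, ∃ η' > 0, ∀ x ∈ Ω, M - η' < w x →
      ∃ y ∈ T, M - η < w y ∧ ‖x‖ ^ 2 + ε ^ 2 / 4 ≤ ‖y‖ ^ 2) :
    ∀ y ∈ T, w y ≤ 0 := by
  intro y₀ hy₀
  by_contra! hpos
  set M := sSup (w '' T) with hMdef
  have hle : ∀ y ∈ T, w y ≤ M := fun y hy => le_csSup hb ⟨y, hy, rfl⟩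
  have hM : 0 < M := hpos.trans_le (hle y₀ hy₀)
  -- The supremum need not be attained, so the tolerance stays universally quantified: each step
  -- requests a smaller one from the previous step.
  have hfar : ∀ k : ℕ, ∀ η > 0, ∃ y ∈ T, M - η < w y ∧ k * (ε ^ 2 / 4) ≤ ‖y‖ ^ 2 := by
    intro k
    induction k with
    | zero =>
      intro η hη
      obtain ⟨_, ⟨y, hy, rfl⟩, hlt⟩ := exists_lt_of_lt_csSup (s := w '' T) ⟨_, y₀, hy₀, rfl⟩
        (sub_lt_self M hη)
      exact ⟨y, hy, hlt, by simp⟩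
    | succ k ih =>
      intro η hη
      obtain ⟨η', hη', h⟩ := hstep M hM hle η hη
      obtain ⟨x, hx, hxM, hxk⟩ := ih (min M η') (lt_min hM hη')
      have hxΩ : x ∈ Ω := by
        by_contra hx'
        have := hout x hx hx'
        have := min_le_left M η'
        linarith
      obtain ⟨y, hy, hyM, hyx⟩ := h x hxΩ (by
        have := min_le_right M η'
        linarith)
      refine ⟨y, hy, hyM, ?_⟩
      push_cast
      linarith
  obtain ⟨R, hR⟩ := hΩb.exists_norm_le
  obtain ⟨k, hk⟩ := exists_nat_gt (R ^ 2 / (ε ^ 2 / 4))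
  rw [div_lt_iff₀ (by positivity)] at hk
  -- Tolerance `M` gives `w y > 0`, so `y ∈ Ω`, yet `‖y‖` exceeds the bound `R`.
  obtain ⟨y, hy, hyM, hyk⟩ := hfar k M hM
  have hyΩ : y ∈ Ω := by
    by_contra hy'
    have := hout y hy hy'
    linarith
  have := pow_le_pow_left₀ (norm_nonneg y) (hR y hyΩ) 2
  linarith

theorem SatisfiesDPP.le (hΩb : Bornology.IsBounded Ω)
    (hε : 0 < ε) (hα : 0 ≤ α) (hβ : 0 < β) (hαβ : α + β = 1)
    (hn : 2 ≤ n ∨ (n = 1 ∧ 0 < α))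
    (hb₁ : ∃ C : ℝ, ∀ x ∈ thickDomain Ω ε, |u₁ x| ≤ C)
    (hb₂ : ∃ C : ℝ, ∀ x ∈ thickDomain Ω ε, |u₂ x| ≤ C)
    (h₁ : SatisfiesDPP Ω α β ε F u₁) (h₂ : SatisfiesDPP Ω α β ε F u₂)
    (hx : x ∈ thickDomain Ω ε) : u₁ x ≤ u₂ x := by
  obtain ⟨C₁, hC₁⟩ := hb₁
  obtain ⟨C₂, hC₂⟩ := hb₂
  rw [← sub_nonpos]
  refine nonpos_of_exists_farther (w := u₁ - u₂) hΩb hε ⟨C₁ + C₂, ?_⟩ ?_ ?_ x hx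
  · rintro _ ⟨y, hy, rfl⟩
    have := (abs_le.1 (hC₁ y hy)).2
    have := (abs_le.1 (hC₂ y hy)).1
    simp only [Pi.sub_apply]
    linarith
  · intro y hy hyΩ
    simp [h₁.eq_of_notMem hy hyΩ, h₂.eq_of_notMem hy hyΩ]
  · intro M hM hle η hη
    rcases hn with hn | ⟨hn, hα'⟩
    · exact exists_farther_of_two_le hn hε hα hβ hαβ hC₁ hC₂ h₁ h₂ hM hle hη
    · exact exists_farther_of_eq_one hn hε hα' hαβ h₁ h₂ hM hle hη

end OrthogonalTugOfWar

theorem mainTheorem1 {n : ℕ} (Ω : Set (EuclideanSpace ℝ (Fin n)))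
    (hΩo : IsOpen Ω) (hΩc : IsConnected Ω) (hΩb : Bornology.IsBounded Ω)
    (α β ε : ℝ) (hε : 0 < ε) (hα : 0 ≤ α) (hβ : 0 < β) (hαβ : α + β = 1)
    (hn : 2 ≤ n ∨ (n = 1 ∧ 0 < α))
    (F : EuclideanSpace ℝ (Fin n) → ℝ)
    (hF : ∃ K : NNReal, LipschitzOnWith K F (OrthogonalTugOfWar.boundaryStrip Ω ε))
    (u₁ u₂ : EuclideanSpace ℝ (Fin n) → ℝ)
    (hm₁ : AEMeasurable u₁ (volume.restrict (OrthogonalTugOfWar.thickDomain Ω ε)))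
    (hm₂ : AEMeasurable u₂ (volume.restrict (OrthogonalTugOfWar.thickDomain Ω ε)))
    (hb₁ : ∃ C : ℝ, ∀ x ∈ OrthogonalTugOfWar.thickDomain Ω ε, |u₁ x| ≤ C)
    (hb₂ : ∃ C : ℝ, ∀ x ∈ OrthogonalTugOfWar.thickDomain Ω ε, |u₂ x| ≤ C)
    (hu₁ : OrthogonalTugOfWar.SatisfiesDPP Ω α β ε F u₁)
    (hu₂ : OrthogonalTugOfWar.SatisfiesDPP Ω α β ε F u₂) :
    EqOn u₁ u₂ (OrthogonalTugOfWar.thickDomain Ω ε) := by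
  exact fun x hx => le_antisymm
    (hu₁.le hΩb hε hα hβ hαβ hn hb₁ hb₂ hu₂ hx) (hu₂.le hΩb hε hα hβ hαβ hn hb₂ hb₁ hu₁ hx)
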